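/- Let $\beta = (\beta_L)_{L \in \mathbb{N}}$ be a sequence of integers with $\beta_L \ge 2$ for every $L \ge 0$, and put $\beta^L = \beta_0 \beta_1 \cdots \beta_{L-1}$ (so $\beta^0 = 1$). For $n \in \mathbb{N} = \{0, 1, 2, \ldots\}$ let $n_L = \lfloor n/\beta^L \rfloor \bmod \beta_L$ be the $L$th digit of $n$ in the mixed base $\beta$, and let $n \oplus h = \sum_{L \ge 0} \big((n_L + h_L) \bmod \beta_L\big)\,\beta^L$ be addition without carry in base $\beta$. For $m \in \mathbb{N}$ define $\sigma^{\beta,m} : \mathbb{N}^m \to \mathbb{N}$ by $\sigma^{\beta,m}(x^0, \ldots, x^{m-1}) = x^0 \oplus \cdots \oplus x^{m-1}$. For $\mathscr{C} \subseteq \mathbb{N}^m \setminus \{(0,\ldots,0)\}$, the take-away game $\Gamma(\mathbb{N}^m, \mathscr{C})$ is the game with set of positions $\mathbb{N}^m$ in which $Y$ is an option of $X$ if and only if $X - Y \in \mathscr{C}$. Its Sprague-Grundy function assigns to $X$ the least nonnegative integer that is not the Sprague-Grundy value of an option of $X$. The set $\mathscr{C}$ is called a Sprague-Grundy system of $\sigma^{\beta,m}$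 if the Sprague-Grundy function of $\Gamma(\mathbb{N}^m, \mathscr{C})$ equals $\sigma^{\beta,m}$. It is called symmetric if $(c^{\pi(0)}, \ldots, c^{\pi(m-1)}) \in \mathscr{C}$ for every $(c^0, \ldots, c^{m-1}) \in \mathscr{C}$ and every permutation $\pi$ of $\{0, \ldots, m-1\}$. A minimal symmetric system of $\sigma^{\beta,m}$ is a symmetric Sprague-Grundy system of $\sigma^{\beta,m}$ that is minimal, with respect to inclusion, among all symmetric Sprague-Grundy systems of $\sigma^{\beta,m}$. If $\sigma^{\beta,m}$ has a unique minimal symmetric system, then this system is called the minimum symmetric system of $\sigma^{\beta,m}$. Theorem. If $m \ge 2$, then $\sigma^{\beta,m}$ has a minimum symmetric system if and only if $\beta = (\beta_0, 2, 2, \ldots)$ (that is, $\beta_L = 2$ for every $L \ge 1$) or $\beta = (2, 3, 2, 2, \ldots)$ (that is, $\beta_0 = 2$, $\beta_1 = 3$ and $\beta_L = 2$ for every $L \ge 2$). -/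

import Mathlib

namespace TakeAway

/-! ### Take-away games and their Sprague-Grundy functions -/

/-- The take-away game on the positions `ℕ^m` determined by a set `𝒞` of moves: there is an edge
from `X` to `Y` (that is, `Y` is an option of `X`) iff the difference `X - Y` lies in `𝒞`. -/
def game {m : ℕ} (𝒞 : Set (Fin m → ℕ)) : Digraph (Fin m → ℕ) where
  Adj X Y := ∃ C ∈ 𝒞, Y + C = X

theorem lt_of_adj {m : ℕ} {𝒞 : Set (Fin m → ℕ)} (h0 : 0 ∉ 𝒞) {X Y : Fin m → ℕ}
    (h : (game 𝒞).Adj X Y) : Y < X := by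
  obtain ⟨C, hC, rfl⟩ := h
  refine lt_of_le_of_ne (fun i => Nat.le_add_right _ _) fun he => h0 ?_
  have : C = 0 := by
    funext i
    have := congrFun he i
    simp only [Pi.add_apply, Pi.zero_apply] at this ⊢
    omega
  exact this ▸ hC

/-- The Sprague-Grundy function of `game 𝒞`: the least natural number that is not the value of an
option. The guard `Y < X` only serves to make the recursion well-founded; it holds for
every option as soon as `0 ∉ 𝒞`, see `sg_isLeast` below. -/
noncomputable def sg {m : ℕ} (𝒞 : Set (Fin m → ℕ)) (X : Fin m → ℕ) : ℕ :=
  sInf {n : ℕ | ∀ (Y : Fin m → ℕ) (_ : Y < X), (game 𝒞).Adj X Y → sg 𝒞 Y ≠ n}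
termination_by wellFounded_lt.wrap X

/-- If `0 ∉ 𝒞`, then `sg 𝒞 X` is the minimum of the natural numbers `n` such that
`X` has no option of Sprague-Grundy value `n`. -/
theorem sg_isLeast {m : ℕ} {𝒞 : Set (Fin m → ℕ)} (h0 : 0 ∉ 𝒞) (X : Fin m → ℕ) :
    IsLeast {n : ℕ | ∀ Y : Fin m → ℕ, (game 𝒞).Adj X Y → sg 𝒞 Y ≠ n} (sg 𝒞 X) := by
  have hset : {n : ℕ | ∀ (Y : Fin m → ℕ) (_ : Y < X), (game 𝒞).Adj X Y → sg 𝒞 Y ≠ n} =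
      {n : ℕ | ∀ Y : Fin m → ℕ, (game 𝒞).Adj X Y → sg 𝒞 Y ≠ n} := by
    ext n
    exact ⟨fun h Y hY => h Y (lt_of_adj h0 hY) hY, fun h Y _ hY => h Y hY⟩
  have hfin : (sg 𝒞 '' Set.Iic X).Finite := (Set.finite_Iic X).image _
  obtain ⟨n, hn⟩ := hfin.infinite_compl.nonempty
  have hne : {n : ℕ | ∀ Y : Fin m → ℕ, (game 𝒞).Adj X Y → sg 𝒞 Y ≠ n}.Nonempty :=
    ⟨n, fun Y hY he => hn ⟨Y, (lt_of_adj h0 hY).le, he⟩⟩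
  rw [sg, hset]
  exact ⟨Nat.sInf_mem hne, fun k hk => Nat.sInf_le hk⟩

/-- `𝒞 ⊆ ℕ^m ∖ {0}` is a Sprague-Grundy system of `φ : ℕ^m → ℕ` if the Sprague-Grundy function
of the take-away game with set of moves `𝒞` is `φ`. -/
def IsSGSystem {m : ℕ} (φ : (Fin m → ℕ) → ℕ) (𝒞 : Set (Fin m → ℕ)) : Prop :=
  0 ∉ 𝒞 ∧ ∀ X : Fin m → ℕ, sg 𝒞 X = φ X

/-! ### Symmetric systems -/

/-- A subset of `ℕ^m` is symmetric if it is closed under permuting coordinates. -/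
def IsSymmetric {m : ℕ} (𝓑 : Set (Fin m → ℕ)) : Prop :=
  ∀ B ∈ 𝓑, ∀ π : Equiv.Perm (Fin m), (fun i => B (π i)) ∈ 𝓑

/-- A minimal symmetric system of `φ`: a symmetric Sprague-Grundy system of `φ` that is minimal,
with respect to inclusion, among all symmetric Sprague-Grundy systems of `φ`. -/
def IsMinimalSymmetricSystem {m : ℕ} (φ : (Fin m → ℕ) → ℕ) (𝒞 : Set (Fin m → ℕ)) : Prop :=
  Minimal (fun 𝒟 : Set (Fin m → ℕ) => IsSymmetric 𝒟 ∧ IsSGSystem φ 𝒟) 𝒞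

/-- `φ` has a minimum symmetric system if it has exactly one minimal symmetric system. -/
def HasMinimumSymmetricSystem {m : ℕ} (φ : (Fin m → ℕ) → ℕ) : Prop :=
  ∃! 𝒞 : Set (Fin m → ℕ), IsMinimalSymmetricSystem φ 𝒞

/-! ### Addition without carry in a mixed base -/

/-- The place value `β_0 * β_1 * ⋯ * β_{L-1}`. -/
def place (β : ℕ → ℕ) (L : ℕ) : ℕ := ∏ i ∈ Finset.range L, β i

/-- The `L`th digit of `n` in the mixed base `β`. -/
def digit (β : ℕ → ℕ) (n L : ℕ) : ℕ := n / place β L % β L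

/-- The sum of `n` and `h` without carry in the mixed base `β`, as the sum over all `L` of
`((n_L + h_L) mod β_L) * (β_0 ⋯ β_{L-1})`. Only finitely many terms are nonzero when all `β L` are
at least `2`, see `nimAdd_support_finite`. -/
noncomputable def nimAdd (β : ℕ → ℕ) (n h : ℕ) : ℕ :=
  ∑ᶠ L : ℕ, (digit β n L + digit β h L) % β L * place β L

theorem digit_eq_zero {β : ℕ → ℕ} (hβ : ∀ L, 2 ≤ β L) {n L : ℕ} (h : n ≤ L) :
    digit β n L = 0 := by
  have h2 : 2 ^ L ≤ place β L := by
    simpa [place] using Finset.prod_le_prod' (s := Finset.range L) (fun i _ => hβ i)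
  have h3 : n < place β L := (h.trans_lt Nat.lt_two_pow_self).trans_le h2
  simp [digit, Nat.div_eq_of_lt h3]

theorem nimAdd_support_finite {β : ℕ → ℕ} (hβ : ∀ L, 2 ≤ β L) (n h : ℕ) :
    (Function.support fun L : ℕ =>
      (digit β n L + digit β h L) % β L * place β L).Finite := by
  refine (Set.finite_Iio (n + h)).subset fun L hL => ?_
  by_contra hlt
  simp only [Set.mem_Iio, not_lt] at hlt
  exact hL (by simp [digit_eq_zero hβ (show n ≤ L by omega), digit_eq_zero hβ (show h ≤ L by omega)])

/-- The mixed-base Nim sum `x^0 ⊕ x^1 ⊕ ⋯ ⊕ x^{m-1}` of the coordinates of `X`. -/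
noncomputable def nimSum (β : ℕ → ℕ) (m : ℕ) (X : Fin m → ℕ) : ℕ :=
  (List.ofFn X).foldr (nimAdd β) 0

end TakeAway

/-! A set of moves is a system of `φ` exactly when no move preserves `φ` and every smaller value is
reachable from every position (`isSGSystem_iff`). A Zorn argument, using that a position has
finitely many moves, shows that a minimum symmetric system is the same as a symmetric system
contained in all symmetric systems (`hasMinimumSymmetricSystem_iff`).

Nonexistence: exhibit a position and a smaller value reachable only by moves `(c, d)` in two heaps,
each of which is dispensable. The digits below place `L` of one heap of the target can be altered
and the other heap made to compensate, so that another admissible move does the same job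
(`exists_system_disjoint_pairOrbit`). Hence no such move lies in every symmetric system. This needs
enough room below place `L`: either `place β L ≥ 3`, or `place β L = 2` with `c` and `d` far enough
apart, which `β 1 ≥ 4` allows.

Existence: where the leading digit to be changed has base `2`, a single-heap move suffices, and
single-heap moves belong to every system. The exceptional digit (the units digit, or the digit of
base `3`) needs only a few more moves, and each of them is forced as the sole way, up to symmetry,
to reach a certain value. -/

namespace TakeAway

/-! ### Digits in a mixed base -/

section Digits

variable {β : ℕ → ℕ}

theorem place_succ (β : ℕ → ℕ) (L : ℕ) : place β (L + 1) = place β L * β L :=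
  Finset.prod_range_succ _ _

theorem place_pos (hβ : ∀ L, 2 ≤ β L) (L : ℕ) : 0 < place β L :=
  Finset.prod_pos fun i _ => lt_of_lt_of_le (by norm_num) (hβ i)

theorem place_dvd (β : ℕ → ℕ) {L M : ℕ} (h : L ≤ M) : place β L ∣ place β M :=
  Finset.prod_dvd_prod_of_subset _ _ _ (Finset.range_subset_range.2 h)

theorem two_pow_le_place (hβ : ∀ L, 2 ≤ β L) (L : ℕ) : 2 ^ L ≤ place β L := by
  simpa [place] using Finset.prod_le_prod' (s := Finset.range L) (fun i _ => hβ i)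

theorem lt_place (hβ : ∀ L, 2 ≤ β L) {n L : ℕ} (h : n ≤ L) : n < place β L :=
  (h.trans_lt Nat.lt_two_pow_self).trans_le (two_pow_le_place hβ L)

theorem digit_lt (hβ : ∀ L, 2 ≤ β L) (n L : ℕ) : digit β n L < β L :=
  Nat.mod_lt _ (lt_of_lt_of_le (by norm_num) (hβ L))

@[simp]
theorem digit_of_zero (β : ℕ → ℕ) (L : ℕ) : digit β 0 L = 0 := by simp [digit]

theorem digit_at_zero (β : ℕ → ℕ) (n : ℕ) : digit β n 0 = n % β 0 := by simp [digit, place]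

theorem digit_at_one (β : ℕ → ℕ) (n : ℕ) : digit β n 1 = n / β 0 % β 1 := by
  simp [digit, place]

theorem div_place_succ (β : ℕ → ℕ) (n L : ℕ) :
    n / place β (L + 1) = n / place β L / β L := by
  rw [place_succ, Nat.div_div_eq_div_mul]

theorem div_place_eq (β : ℕ → ℕ) (n L : ℕ) :
    n / place β L = digit β n L + β L * (n / place β (L + 1)) := by
  rw [div_place_succ, digit, Nat.mod_add_div]

/-- Equality of quotients by `place β K` is the form in which agreement of all digits from `K`
upward is used throughout. -/
theorem digit_eq_of_div_eq {a b K L : ℕ} (h : a / place β K = b / place β K) (hKL : K ≤ L) :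
    digit β a L = digit β b L := by
  have : a / place β L = b / place β L := by
    induction L, hKL using Nat.le_induction with
    | base => exact h
    | succ L _ ih => rw [div_place_succ, div_place_succ, ih]
  rw [digit, digit, this]

theorem div_eq_of_digit_eq (hβ : ∀ L, 2 ≤ β L) {a b K : ℕ}
    (h : ∀ L, K ≤ L → digit β a L = digit β b L) : a / place β K = b / place β K := by
  -- Downward induction on `K`: both numbers are below `place β (K + j)`, so `j` bounds the number
  -- of digits still to be compared.
  have key : ∀ j K, a ≤ K + j → b ≤ K + j → (∀ L, K ≤ L → digit β a L = digit β b L) →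
      a / place β K = b / place β K := by
    intro j
    induction j with
    | zero =>
      intro K ha hb _
      rw [Nat.div_eq_of_lt (lt_place hβ (show a ≤ K from ha)),
        Nat.div_eq_of_lt (lt_place hβ (show b ≤ K from hb))]
    | succ j ih =>
      intro K ha hb hd
      rw [div_place_eq, div_place_eq β b, hd K le_rfl,
        ih (K + 1) (by omega) (by omega) fun L hL => hd L (by omega)]
  exact key (a + b) K (by omega) (by omega) h

theorem eq_of_digit_eq (hβ : ∀ L, 2 ≤ β L) {a b : ℕ}
    (h : ∀ L, digit β a L = digit β b L) : a = b := by
  simpa [place] using div_eq_of_digit_eq hβ (K := 0) fun L _ => h L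

theorem lt_of_digit_lt {a b N : ℕ}
    (h : a / place β (N + 1) = b / place β (N + 1)) (hN : digit β a N < digit β b N) : a < b := by
  have : a / place β N < b / place β N := by
    rw [div_place_eq, div_place_eq β b, h]
    omega
  by_contra hab
  exact absurd (Nat.div_le_div_right (c := place β N) (not_lt.1 hab)) (not_le.2 this)

theorem exists_digit_lt (hβ : ∀ L, 2 ≤ β L) {a b : ℕ} (h : a < b) :
    ∃ N, a / place β (N + 1) = b / place β (N + 1) ∧ digit β a N < digit β b N := by
  classical
  -- The least `K` with equal quotients is `N + 1`, where `N` is the most significant differing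
  -- place.
  have hex : ∃ K, a / place β K = b / place β K :=
    ⟨b, by rw [Nat.div_eq_of_lt (lt_place hβ h.le), Nat.div_eq_of_lt (lt_place hβ le_rfl)]⟩
  have hspec := Nat.find_spec hex
  have hmin := fun k => Nat.find_min hex (m := k)
  rcases hK : Nat.find hex with _ | N
  · rw [hK] at hspec
    simp [place] at hspec
    omega
  · rw [hK] at hspec
    refine ⟨N, hspec, ?_⟩
    have h1 : a / place β N ≠ b / place β N := hmin N (by omega)
    have h2 : a / place β N ≤ b / place β N := Nat.div_le_div_right h.le
    rw [div_place_eq, div_place_eq β b, hspec] at h1 h2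
    omega

theorem sum_place_lt {d : ℕ → ℕ} (hd : ∀ L, d L < β L) (K : ℕ) :
    ∑ L ∈ Finset.range K, d L * place β L < place β K := by
  induction K with
  | zero => simp [place]
  | succ K ih =>
    rw [Finset.sum_range_succ, place_succ]
    have := Nat.mul_le_mul_left (place β K) (hd K)
    nlinarith

theorem digit_eq_mod_div (β : ℕ → ℕ) (n L : ℕ) :
    digit β n L = n % place β (L + 1) / place β L := by
  rw [place_succ, Nat.mod_mul_right_div_self, digit]

theorem digit_sum_place {d : ℕ → ℕ} (hd : ∀ L, d L < β L) (K L : ℕ) :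
    digit β (∑ l ∈ Finset.range K, d l * place β l) L = if L < K then d L else 0 := by
  have hp : ∀ L, 0 < place β L := fun L =>
    Finset.prod_pos fun i _ => (Nat.zero_le _).trans_lt (hd i)
  induction K with
  | zero => simp
  | succ K ih =>
    rcases lt_trichotomy L K with h | rfl | h
    · rw [if_pos (by omega), Finset.sum_range_succ, digit_eq_mod_div]
      obtain ⟨q, hq⟩ := place_dvd β (show L + 1 ≤ K from h)
      rw [hq, mul_left_comm, Nat.add_mul_mod_self_left, ← digit_eq_mod_div, ih, if_pos h]
    · rw [if_pos (by omega), Finset.sum_range_succ, digit, Nat.add_mul_div_right _ _ (hp L),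
        Nat.div_eq_of_lt (sum_place_lt hd L), zero_add, Nat.mod_eq_of_lt (hd L)]
    · rw [if_neg (by omega), digit, Nat.div_eq_of_lt, Nat.zero_mod]
      exact (sum_place_lt hd (K + 1)).trans_le (Nat.le_of_dvd (hp L) (place_dvd β h))

theorem exists_digit_eq {d : ℕ → ℕ} (hd : ∀ L, d L < β L) {K : ℕ}
    (hK : ∀ L, K ≤ L → d L = 0) : ∃ n, ∀ L, digit β n L = d L := by
  refine ⟨∑ l ∈ Finset.range K, d l * place β l, fun L => ?_⟩
  rw [digit_sum_place hd]
  split_ifs with h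
  · rfl
  · exact (hK L (not_lt.1 h)).symm

theorem digit_nimAdd (hβ : ∀ L, 2 ≤ β L) (a b L : ℕ) :
    digit β (nimAdd β a b) L = (digit β a L + digit β b L) % β L := by
  have hz : ∀ L, a + b ≤ L → (digit β a L + digit β b L) % β L = 0 := fun L hL => by
    simp [digit_eq_zero hβ (show a ≤ L by omega), digit_eq_zero hβ (show b ≤ L by omega)]
  have : nimAdd β a b =
      ∑ l ∈ Finset.range (a + b), (digit β a l + digit β b l) % β l * place β l := by
    refine finsum_eq_sum_of_support_subset _ fun l hl => ?_
    by_contra hlt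
    simp only [Finset.coe_range, Set.mem_Iio, not_lt] at hlt
    exact hl (by simp [hz l hlt])
  rw [this, digit_sum_place (d := fun l => (digit β a l + digit β b l) % β l)
    (fun l => Nat.mod_lt _ (lt_of_lt_of_le (by norm_num) (hβ l)))]
  split_ifs with h
  · rfl
  · exact (hz L (not_lt.1 h)).symm

theorem digit_nimSum (hβ : ∀ L, 2 ≤ β L) {m : ℕ} (X : Fin m → ℕ) (L : ℕ) :
    digit β (nimSum β m X) L = (∑ i, digit β (X i) L) % β L := by
  induction m with
  | zero => simp [nimSum]
  | succ m ih =>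
    have : nimSum β (m + 1) X = nimAdd β (X 0) (nimSum β m fun i => X i.succ) := by
      simp [nimSum, List.ofFn_succ]
    rw [this, digit_nimAdd hβ, ih, Fin.sum_univ_succ, Nat.add_mod_mod]

theorem nimSum_mod (hβ : ∀ L, 2 ≤ β L) {m : ℕ} (X : Fin m → ℕ) :
    nimSum β m X % β 0 = (∑ i, X i) % β 0 := by
  have := digit_nimSum hβ X 0
  simp only [digit_at_zero] at this
  rw [this, ← Finset.sum_nat_mod]

theorem nimSum_comp_perm (hβ : ∀ L, 2 ≤ β L) {m : ℕ} (X : Fin m → ℕ) (π : Equiv.Perm (Fin m)) :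
    nimSum β m (fun i => X (π i)) = nimSum β m X := by
  refine eq_of_digit_eq hβ fun L => ?_
  rw [digit_nimSum hβ, digit_nimSum hβ, Equiv.sum_comp π fun i => digit β (X i) L]

theorem nimSum_zero (hβ : ∀ L, 2 ≤ β L) {m : ℕ} : nimSum β m (0 : Fin m → ℕ) = 0 :=
  eq_of_digit_eq hβ fun L => by simp [digit_nimSum hβ]

theorem sum_update_add {m : ℕ} (f : ℕ → ℕ) (X : Fin m → ℕ) (i : Fin m) (y : ℕ) :
    ∑ k, f (Function.update X i y k) + f (X i) = ∑ k, f (X k) + f y := by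
  rw [← Finset.add_sum_erase _ _ (Finset.mem_univ i),
    ← Finset.add_sum_erase _ (fun k => f (X k)) (Finset.mem_univ i)]
  have : ∑ k ∈ Finset.univ.erase i, f (Function.update X i y k) =
      ∑ k ∈ Finset.univ.erase i, f (X k) :=
    Finset.sum_congr rfl fun k hk => by rw [Function.update_of_ne (Finset.ne_of_mem_erase hk)]
  rw [this, Function.update_self]
  ring

/-- Any value can be reached by changing the `i`th coordinate only. -/
theorem exists_nimSum_update_eq (hβ : ∀ L, 2 ≤ β L) {m : ℕ} (X : Fin m → ℕ) (i : Fin m) (h : ℕ) :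
    ∃ y, nimSum β m (Function.update X i y) = h ∧ ∀ L, digit β y L =
      (digit β h L + (β L - digit β (nimSum β m X) L) + digit β (X i) L) % β L := by
  set s := nimSum β m X with hs
  have hpos : ∀ L, 0 < β L := fun L => lt_of_lt_of_le (by norm_num) (hβ L)
  -- The new digit must be `h - s + x` modulo `β L`; adding `β L` avoids truncated subtraction.
  obtain ⟨y, hy⟩ := exists_digit_eq (β := β)
    (d := fun L => (digit β h L + (β L - digit β s L) + digit β (X i) L) % β L)
    (fun L => Nat.mod_lt _ (hpos L)) (K := h + s + X i) fun L hL => by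
      simp [digit_eq_zero hβ (show h ≤ L by omega), digit_eq_zero hβ (show s ≤ L by omega),
        digit_eq_zero hβ (show X i ≤ L by omega)]
  refine ⟨y, eq_of_digit_eq hβ fun L => ?_, hy⟩
  have h1 := sum_update_add (fun n => digit β n L) X i y
  have h2 := digit_nimSum hβ X L
  have h3 := (digit_lt hβ s L).le
  rw [← hs] at h2
  have hlt := digit_lt hβ h L
  rw [digit_nimSum hβ]
  rw [← Nat.mod_eq_of_lt hlt]
  change _ ≡ _ [MOD β L]
  have hy' := hy L
  rw [← ZMod.natCast_eq_natCast_iff]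
  have c1 := congrArg (Nat.cast : ℕ → ZMod (β L)) h1
  have c2 := congrArg (Nat.cast : ℕ → ZMod (β L)) h2
  have c3 := congrArg (Nat.cast : ℕ → ZMod (β L)) hy'
  rw [ZMod.natCast_mod] at c2 c3
  push_cast [Nat.cast_sub h3] at c1 c2 c3 ⊢
  rw [ZMod.natCast_self] at c3
  linear_combination c1 + c3 - c2

theorem eq_of_nimSum_update_eq (hβ : ∀ L, 2 ≤ β L) {m : ℕ} (X : Fin m → ℕ) (i : Fin m) {y : ℕ}
    (hy : nimSum β m (Function.update X i y) = nimSum β m X) : y = X i := by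
  refine eq_of_digit_eq hβ fun L => ?_
  have h1 := sum_update_add (fun n => digit β n L) X i y
  have h2 := digit_nimSum hβ X L
  have h3 := digit_nimSum hβ (Function.update X i y) L
  rw [hy, h2] at h3
  have h4 : digit β y L ≡ digit β (X i) L [MOD β L] := by
    rw [← ZMod.natCast_eq_natCast_iff]
    have h3' : (∑ i, digit β (X i) L) ≡ (∑ k, digit β (Function.update X i y k) L) [MOD β L] := h3
    rw [← ZMod.natCast_eq_natCast_iff] at h3'
    have c1 := congrArg (Nat.cast : ℕ → ZMod (β L)) h1
    push_cast at c1 h3' ⊢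
    linear_combination -c1 - h3'
  exact Nat.ModEq.eq_of_lt_of_lt h4 (digit_lt hβ _ _) (digit_lt hβ _ _)

/-- The single-heap moves: a coordinate whose leading relevant digit is large enough can be lowered
so as to reach a smaller value `h`. -/
theorem exists_lt_nimSum_update_eq (hβ : ∀ L, 2 ≤ β L) {m : ℕ} (X : Fin m → ℕ) (i : Fin m)
    {h N : ℕ} (hhigh : h / place β (N + 1) = nimSum β m X / place β (N + 1))
    (hlt : digit β h N < digit β (nimSum β m X) N)
    (hi : digit β (nimSum β m X) N ≤ digit β (X i) N + digit β h N) :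
    ∃ y < X i, nimSum β m (Function.update X i y) = h := by
  obtain ⟨y, hy, hd⟩ := exists_nimSum_update_eq hβ X i h
  refine ⟨y, lt_of_digit_lt (N := N) (div_eq_of_digit_eq hβ fun L hL => ?_) ?_, hy⟩
  · have h3 := (digit_lt hβ (nimSum β m X) L).le
    rw [hd, digit_eq_of_div_eq hhigh hL, Nat.add_sub_cancel' h3, Nat.add_mod_left,
      Nat.mod_eq_of_lt (digit_lt hβ _ _)]
  -- By `hi` the new digit is `x + h - s` without wraparound, which is below `x` since `h < s` at
  -- place `N`.
  · have h3 := (digit_lt hβ (nimSum β m X) N)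
    have h4 := digit_lt hβ (X i) N
    rw [hd, show digit β h N + (β N - digit β (nimSum β m X) N) + digit β (X i) N =
      (digit β (X i) N + digit β h N - digit β (nimSum β m X) N) + β N by omega,
      Nat.add_mod_right, Nat.mod_eq_of_lt (by omega)]
    omega

end Digits

/-! ### Systems -/

section Systems

variable {m : ℕ} {φ : (Fin m → ℕ) → ℕ}

/-- The mex recursion determines its solution by well-founded induction, so checking `φ` against the
mex rule locally is enough. -/
theorem isSGSystem_iff {𝒞 : Set (Fin m → ℕ)} :
    IsSGSystem φ 𝒞 ↔ (∀ C ∈ 𝒞, ∀ Y, φ (Y + C) ≠ φ Y) ∧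
      ∀ X, ∀ h < φ X, ∃ C ∈ 𝒞, ∃ Y, Y + C = X ∧ φ Y = h := by
  constructor
  · rintro ⟨h0, hsg⟩
    refine ⟨fun C hC Y he => ?_, fun X h hh => ?_⟩
    · have := (sg_isLeast h0 (Y + C)).1 Y ⟨C, hC, rfl⟩
      rw [hsg, hsg] at this
      exact this he.symm
    · by_contra! hno
      have : sg 𝒞 X ≤ h := (sg_isLeast h0 X).2 fun Y hY he => by
        obtain ⟨C, hC, hYC⟩ := hY
        exact hno C hC Y hYC (by rw [← hsg, he])
      rw [hsg] at this
      omega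
  · rintro ⟨hne, hex⟩
    have h0 : (0 : Fin m → ℕ) ∉ 𝒞 := fun h => hne 0 h 0 (by simp)
    refine ⟨h0, fun X => ?_⟩
    induction X using (wellFounded_lt (α := Fin m → ℕ)).induction with
    | _ X ih =>
      refine (sg_isLeast h0 X).unique ⟨fun Y hY => ?_, fun n hn => ?_⟩
      · rw [ih Y (lt_of_adj h0 hY)]
        obtain ⟨C, hC, rfl⟩ := hY
        exact (hne C hC Y).symm
      · by_contra hlt
        obtain ⟨C, hC, Y, hYC, hY⟩ := hex X n (not_le.1 hlt)
        have hadj : (game 𝒞).Adj X Y := ⟨C, hC, hYC⟩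
        exact hn Y hadj (by rw [ih Y (lt_of_adj h0 hadj), hY])

/-- Every symmetric system contains a minimal one. -/
theorem exists_isMinimalSymmetricSystem_subset {𝒞 : Set (Fin m → ℕ)} (hs : IsSymmetric 𝒞)
    (hsg : IsSGSystem φ 𝒞) : ∃ ℳ ⊆ 𝒞, IsMinimalSymmetricSystem φ ℳ := by
  refine zorn_superset_nonempty {𝒟 | IsSymmetric 𝒟 ∧ IsSGSystem φ 𝒟} ?_ 𝒞 ⟨hs, hsg⟩
  intro c hc hchain ⟨s₀, hs₀⟩
  refine ⟨⋂₀ c, ⟨fun B hB π s hsc => (hc hsc).1 B (hB s hsc) π, isSGSystem_iff.2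
    ⟨fun C hC => (isSGSystem_iff.1 (hc hs₀).2).1 C (hC s₀ hs₀), fun X h hh => ?_⟩⟩,
    fun s hsc => Set.sInter_subset_of_mem hsc⟩
  set F : Set (Fin m → ℕ) := {C | ∃ Y, Y + C = X ∧ φ Y = h} with hF
  have hFfin : F.Finite := (Set.finite_Iic X).subset fun C ⟨Y, hY, _⟩ i => by
    have hi : Y i + C i = X i := congrFun hY i
    exact (Nat.le_add_left _ _).trans_eq hi
  -- Only finitely many moves lead from `X` to value `h`. A member of the chain with fewest of them
  -- shares them with all smaller members, so such a move survives in the intersection.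
  have : ∃ s ∈ c, ∀ s' ∈ c, (F ∩ s).ncard ≤ (F ∩ s').ncard := by
    obtain ⟨n, ⟨s, hs, rfl⟩, hmin⟩ := WellFounded.has_min (wellFounded_lt (α := ℕ))
      ((fun s => (F ∩ s).ncard) '' c) ⟨_, s₀, hs₀, rfl⟩
    exact ⟨s, hs, fun s' hs' => not_lt.1 (hmin _ ⟨s', hs', rfl⟩)⟩
  obtain ⟨s, hsc, hmin⟩ := this
  obtain ⟨C, hC, Y, hY⟩ := (isSGSystem_iff.1 (hc hsc).2).2 X h hh
  refine ⟨C, fun s' hs' => ?_, Y, hY⟩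
  rcases hchain.total hsc hs' with h1 | h1
  · exact h1 hC
  · have := Set.eq_of_subset_of_ncard_le (Set.inter_subset_inter_right F h1) (hmin s' hs')
      (hFfin.subset Set.inter_subset_left)
    have hCF : C ∈ F ∩ s := ⟨⟨Y, hY⟩, hC⟩
    rw [← this] at hCF
    exact hCF.2

theorem hasMinimumSymmetricSystem_iff : HasMinimumSymmetricSystem φ ↔
    ∃ ℳ, IsSymmetric ℳ ∧ IsSGSystem φ ℳ ∧
      ∀ 𝒟, IsSymmetric 𝒟 → IsSGSystem φ 𝒟 → ℳ ⊆ 𝒟 := by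
  constructor
  · rintro ⟨ℳ, hℳ, huniq⟩
    refine ⟨ℳ, hℳ.prop.1, hℳ.prop.2, fun 𝒟 h1 h2 => ?_⟩
    obtain ⟨𝒩, hsub, hmin⟩ := exists_isMinimalSymmetricSystem_subset h1 h2
    rw [← huniq 𝒩 hmin]
    exact hsub
  · rintro ⟨ℳ, h1, h2, hle⟩
    refine ⟨ℳ, ⟨⟨h1, h2⟩, fun 𝒟 h𝒟 _ => hle 𝒟 h𝒟.1 h𝒟.2⟩, fun 𝒩 h𝒩 => ?_⟩
    exact (h𝒩.le_of_le ⟨h1, h2⟩ (hle 𝒩 h𝒩.prop.1 h𝒩.prop.2)).antisymm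
      (hle 𝒩 h𝒩.prop.1 h𝒩.prop.2)

/-- A symmetric set of moves each of which can always be replaced by an admissible move outside
this set is disjoint from some symmetric system. -/
theorem exists_system_disjoint (hφ : ∀ X (π : Equiv.Perm (Fin m)), φ (fun i => X (π i)) = φ X)
    {𝒞 𝒪 : Set (Fin m → ℕ)} (h𝒞 : IsSGSystem φ 𝒞) (h𝒪 : IsSymmetric 𝒪)
    (halt : ∀ C ∈ 𝒪, ∀ Y, ∃ C' Y', Y' + C' = Y + C ∧ φ Y' = φ Y ∧ C' ∉ 𝒪 ∧
      ∀ Z, φ (Z + C') ≠ φ Z) :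
    ∃ 𝒟, IsSymmetric 𝒟 ∧ IsSGSystem φ 𝒟 ∧ ∀ C ∈ 𝒪, C ∉ 𝒟 := by
  -- The new system consists of all admissible moves outside `𝒪`.
  refine ⟨{C | (∀ Z, φ (Z + C) ≠ φ Z) ∧ C ∉ 𝒪}, fun B ⟨hB, hB𝒪⟩ π => ⟨fun Z he => ?_, fun h => ?_⟩,
    isSGSystem_iff.2 ⟨fun C hC => hC.1, fun X h hh => ?_⟩, fun C hC h => h.2 hC⟩
  · apply hB fun i => Z (π.symm i)
    rw [hφ Z π.symm, ← he, ← hφ _ π]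
    congr 1
    funext i
    simp
  · have := h𝒪 _ h π.symm
    simp only [Equiv.apply_symm_apply] at this
    exact hB𝒪 this
  · rw [isSGSystem_iff] at h𝒞
    obtain ⟨C, hC, Y, hY, hval⟩ := h𝒞.2 X h hh
    by_cases hCO : C ∈ 𝒪
    · obtain ⟨C', Y', h1, h2, h3, h4⟩ := halt C hCO Y
      exact ⟨C', ⟨h4, h3⟩, Y', h1.trans hY, h2.trans hval⟩
    · exact ⟨C, ⟨h𝒞.1 C hC, hCO⟩, Y, hY, hval⟩

end Systems

/-! ### Moves in two heaps -/

section Pairs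

variable {m : ℕ}

/-- The vector with entries `a` at `i`, `b` at `j`, and `0` elsewhere. -/
def pairAt (i j : Fin m) (a b : ℕ) : Fin m → ℕ :=
  fun k => if k = i then a else if k = j then b else 0

/-- The permutations of `(a, b, 0, …, 0)`. -/
def pairOrbit (m a b : ℕ) : Set (Fin m → ℕ) :=
  {B | ∃ i j : Fin m, i ≠ j ∧ B = pairAt i j a b}

@[simp]
theorem pairAt_left (i j : Fin m) (a b : ℕ) : pairAt i j a b i = a := by simp [pairAt]

theorem pairAt_right {i j : Fin m} (hij : i ≠ j) (a b : ℕ) : pairAt i j a b j = b := by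
  simp [pairAt, hij.symm]

theorem pairAt_comm {i j : Fin m} (hij : i ≠ j) (a b : ℕ) : pairAt i j a b = pairAt j i b a := by
  funext k
  simp only [pairAt]
  split_ifs with h1 h2 <;> first | rfl | exact absurd (h1.symm.trans h2) hij

theorem isSymmetric_pairOrbit (m a b : ℕ) : IsSymmetric (pairOrbit m a b) := by
  rintro B ⟨i, j, hij, rfl⟩ π
  refine ⟨π.symm i, π.symm j, fun h => hij (π.symm.injective h), ?_⟩
  funext k
  simp only [pairAt, Equiv.eq_symm_apply]

theorem pairAt_mem_of_mem {𝒟 : Set (Fin m → ℕ)} (h𝒟 : IsSymmetric 𝒟) {i j k l : Fin m}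
    (hij : i ≠ j) (hkl : k ≠ l) {a b : ℕ} (h : pairAt i j a b ∈ 𝒟) : pairAt k l a b ∈ 𝒟 := by
  obtain ⟨π, hπi, hπj⟩ : ∃ π : Equiv.Perm (Fin m), π k = i ∧ π l = j := by
    refine ⟨(Equiv.swap k i).trans (Equiv.swap (Equiv.swap k i l) j), ?_, ?_⟩
    · have h1 : i ≠ Equiv.swap k i l := fun he => hkl <| by
        have := congrArg (Equiv.swap k i) he
        simpa using this
      simp [Equiv.swap_apply_of_ne_of_ne h1 hij]
    · simp
  have := h𝒟 _ h π
  convert this using 1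
  funext t
  simp only [pairAt, ← hπi, ← hπj, π.injective.eq_iff]

theorem sum_pairAt {i j : Fin m} (hij : i ≠ j) (a b : ℕ) (f : ℕ → ℕ) (hf : f 0 = 0) :
    ∑ k, f (pairAt i j a b k) = f a + f b := by
  have : ∀ k, f (pairAt i j a b k) = (if k = i then f a else 0) + (if k = j then f b else 0) := by
    intro k
    simp only [pairAt]
    split_ifs with h1 h2 <;> first | exact absurd (h1.symm.trans h2) hij | simp [hf]
  simp [this, Finset.sum_add_distrib]

/-- Both summands of a vector supported on `{i, j}` are supported on `{i, j}`. -/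
theorem add_eq_pairAt {i j : Fin m} (hij : i ≠ j) {a b : ℕ} {Y C : Fin m → ℕ}
    (h : Y + C = pairAt i j a b) : Y = pairAt i j (Y i) (Y j) ∧ C = pairAt i j (C i) (C j) ∧
      Y i + C i = a ∧ Y j + C j = b := by
  have hk : ∀ k, Y k + C k = pairAt i j a b k := fun k => congrFun h k
  refine ⟨funext fun k => ?_, funext fun k => ?_, by simpa using hk i,
    by simpa [pairAt_right hij] using hk j⟩
  all_goals
    have := hk k
    simp only [pairAt] at this ⊢
    split_ifs at this ⊢ with h1 h2
    · rw [h1]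
    · rw [h2]
    · omega

variable {β : ℕ → ℕ}

theorem digit_nimSum_pairAt (hβ : ∀ L, 2 ≤ β L) {i j : Fin m} (hij : i ≠ j) (a b L : ℕ) :
    digit β (nimSum β m (pairAt i j a b)) L = (digit β a L + digit β b L) % β L := by
  rw [digit_nimSum hβ, sum_pairAt hij a b (fun n => digit β n L) (by simp)]

theorem nimSum_pairAt_mod (hβ : ∀ L, 2 ≤ β L) {i j : Fin m} (hij : i ≠ j) (a b : ℕ) :
    nimSum β m (pairAt i j a b) % β 0 = (a + b) % β 0 := by
  rw [nimSum_mod hβ, sum_pairAt hij a b (fun n => n) rfl]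

/-- The units digit of the Nim sum is the ordinary sum modulo `β 0`, so this gives an admissibility
test that depends only on the total of the move. -/
theorem nimSum_add_ne (hβ : ∀ L, 2 ≤ β L) {C : Fin m → ℕ} (hC : (∑ i, C i) % β 0 ≠ 0)
    (Z : Fin m → ℕ) : nimSum β m (Z + C) ≠ nimSum β m Z := by
  intro he
  have h1 := congrArg (· % β 0) he
  simp only [nimSum_mod hβ, Pi.add_apply, Finset.sum_add_distrib] at h1
  apply hC
  have h2 : (∑ i, Z i) + ∑ i, C i ≡ (∑ i, Z i) + 0 [MOD β 0] := h1
  exact Nat.ModEq.add_left_cancel' _ h2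

/-- A move `(c, c')` in two heaps can be avoided by changing the lower digits of one heap, and
compensating for this in the other one. -/
theorem exists_system_disjoint_pairOrbit (hβ : ∀ L, 2 ≤ β L) {L c c' : ℕ}
    {𝒞 : Set (Fin m → ℕ)} (h𝒞 : IsSGSystem (nimSum β m) 𝒞)
    (hc : place β L ≤ c) (hc' : place β L ≤ c' + 1) (hsum : (c + c') % β 0 ≠ 0)
    (hch : ∀ y, ∃ y', y' / place β L = y / place β L ∧ y' ≠ y ∧ y' + c' ≠ y + c) :
    ∃ 𝒟, IsSymmetric 𝒟 ∧ IsSGSystem (nimSum β m) 𝒟 ∧ ∀ C ∈ pairOrbit m c c', C ∉ 𝒟 := by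
  refine exists_system_disjoint (nimSum_comp_perm hβ) h𝒞 (isSymmetric_pairOrbit m c c') ?_
  rintro C ⟨i, j, hij, rfl⟩ Y
  have hQ := place_pos hβ L
  obtain ⟨y', hy, hy1, hy2⟩ := hch (Y i)
  set Z := Function.update Y i y' with hZ
  obtain ⟨w, hw, hwd⟩ := exists_nimSum_update_eq hβ Z j (nimSum β m Y)
  have hZj : Z j = Y j := Function.update_of_ne hij.symm _ _
  have hwj : w / place β L = Y j / place β L := by
    refine div_eq_of_digit_eq hβ fun l hl => ?_
    have h1 := sum_update_add (fun n => digit β n l) Y i y'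
    rw [digit_eq_of_div_eq hy hl, add_left_inj] at h1
    rw [hwd, digit_nimSum hβ Z, hZ, h1, ← digit_nimSum hβ Y, ← hZ, hZj,
      Nat.add_sub_cancel' (digit_lt hβ _ _).le, Nat.add_mod_left,
      Nat.mod_eq_of_lt (digit_lt hβ _ _)]
  have hlt : ∀ a b, a / place β L = b / place β L → a < b + place β L := fun a b h => by
    have h1 := Nat.mod_add_div a (place β L)
    have h2 := Nat.mod_add_div b (place β L)
    have h3 := Nat.mod_lt a hQ
    rw [h] at h1
    omega
  have hi := hlt _ _ hy
  have hj := hlt _ _ hwj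
  set Y' := Function.update Z j w with hY'
  have hY'i : Y' i = y' := by rw [hY', Function.update_of_ne hij, hZ, Function.update_self]
  -- Changing digits below place `L` raises a heap by at most `place β L - 1`; hence the bound on
  -- `c' + 1`. The stronger bound on `c` makes the new move nonzero at `i`.
  have hle : Y' ≤ Y + pairAt i j c c' := by
    intro k
    rw [Pi.add_apply]
    by_cases hkj : k = j
    · subst hkj
      rw [pairAt_right hij, hY', Function.update_self]
      change w ≤ Y k + c'
      omega
    · by_cases hki : k = i
      · subst hki
        rw [pairAt_left, hY'i]
        change y' ≤ Y k + c
        omega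
      · rw [hY', Function.update_of_ne hkj, hZ, Function.update_of_ne hki]
        exact Nat.le_add_right _ _
  obtain ⟨C', hC'⟩ := exists_add_of_le hle
  refine ⟨C', Y', hC'.symm, hw, ?_, nimSum_add_ne hβ fun h0 => ?_⟩
  -- The entry of `C'` at `i` is none of `c`, `c'` and `0`.
  · have h1 := congrFun hC' i
    simp only [Pi.add_apply, pairAt_left, hY'i] at h1
    rintro ⟨k, l, hkl, rfl⟩
    simp only [pairAt] at h1
    split_ifs at h1 <;> omega
  · apply hsum
    have h1 := congrArg (fun X => ∑ k, X k) hC'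
    simp only [Pi.add_apply, Finset.sum_add_distrib] at h1
    rw [sum_pairAt hij c c' (fun n => n) rfl] at h1
    have h2 := congrArg (· % β 0) hw
    simp only [nimSum_mod hβ] at h2
    have h3 : (∑ k, Y k) + (c + c') ≡ (∑ k, Y k) + 0 [MOD β 0] := by
      rw [h1]
      exact Nat.ModEq.add h2 h0
    exact Nat.ModEq.add_left_cancel' _ h3

end Pairs

/-! ### Bases without a minimum symmetric system -/

section Necessity

variable {m : ℕ} {β : ℕ → ℕ}

/-- From `(2Q - 1, 2Q - 1)` to the value `h`, both digits at place `L` must drop from `1` to `0`: as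
`β L ≥ 3`, digits at most `1` sum to zero without wraparound only if both vanish. The choice of `h`
makes the total of the move `1` modulo `β 0`, so it passes the units-digit test. -/
theorem not_hasMinimum_of_three_le_place (hβ : ∀ L, 2 ≤ β L) (hm : 2 ≤ m) {L : ℕ} (hL : 1 ≤ L)
    (hL3 : 3 ≤ β L) (hQ : 3 ≤ place β L) : ¬ HasMinimumSymmetricSystem (nimSum β m) := by
  rw [hasMinimumSymmetricSystem_iff]
  rintro ⟨ℳ, hsymm, hsg, hle⟩
  set Q := place β L with hQdef
  obtain ⟨i, j, hij⟩ : ∃ i j : Fin m, i ≠ j :=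
    ⟨⟨0, by omega⟩, ⟨1, by omega⟩, by simp [Fin.ext_iff]⟩
  set h := nimSum β m (pairAt i j (Q - 1) (Q - 2)) with hh
  have hdiv : h / Q = 0 := by
    have : h / place β L = 0 / place β L := div_eq_of_digit_eq hβ fun l hl => by
      have h0 : ∀ x < Q, digit β x l = 0 := fun x hx => by
        rw [digit_eq_of_div_eq (b := 0) (K := L) (by rw [Nat.div_eq_of_lt hx, Nat.zero_div]) hl,
          digit_of_zero]
      rw [hh, digit_nimSum_pairAt hij (hβ := hβ), h0 _ (by omega), h0 _ (by omega)]
      simp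
    simpa using this
  have hdig : digit β (nimSum β m (pairAt i j (2 * Q - 1) (2 * Q - 1))) L = 2 := by
    have : (2 * Q - 1) / Q = 1 := by
      rw [Nat.div_eq_iff (by omega)]
      omega
    rw [digit_nimSum_pairAt hβ hij, digit, this, Nat.mod_eq_of_lt (show 1 < β L by omega),
      Nat.mod_eq_of_lt (by omega)]
  have hlt : h < nimSum β m (pairAt i j (2 * Q - 1) (2 * Q - 1)) := by
    have h1 : h < Q := (Nat.div_eq_zero_iff_lt (by omega)).1 hdiv
    refine h1.trans_le (not_lt.1 fun h2 => ?_)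
    rw [digit, Nat.div_eq_of_lt h2] at hdig
    simp at hdig
  obtain ⟨C, hC, Y, hYC, hY⟩ := (isSGSystem_iff.1 hsg).2 _ h hlt
  obtain ⟨hY2, hC2, hi, hj⟩ := add_eq_pairAt hij hYC
  generalize Y i = y at *
  generalize Y j = z at *
  generalize C i = c at *
  generalize C j = d at *
  subst hY2 hC2
  have hy0 : y / Q = 0 ∧ z / Q = 0 := by
    have h1 : ∀ x ≤ 2 * Q - 1, x / Q ≤ 1 := fun x hx => by
      rw [← Nat.lt_succ_iff, Nat.div_lt_iff_lt_mul (by omega)]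
      omega
    have h2 := digit_nimSum_pairAt hβ hij y z L
    have hy := h1 y (by omega)
    have hz := h1 z (by omega)
    rw [hY, digit, ← hQdef, hdiv, digit, digit, ← hQdef, Nat.mod_eq_of_lt (a := y / Q) (by omega),
      Nat.mod_eq_of_lt (a := z / Q) (by omega), Nat.mod_eq_of_lt (a := y / Q + _) (by omega),
      Nat.zero_mod] at h2
    exact Nat.add_eq_zero_iff.1 h2.symm
  have hyQ : y < Q := (Nat.div_eq_zero_iff_lt (by omega)).1 hy0.1
  have hzQ : z < Q := (Nat.div_eq_zero_iff_lt (by omega)).1 hy0.2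
  have hsum : (c + d) % β 0 ≠ 0 := by
    intro h0
    have h4 := nimSum_pairAt_mod hβ hij y z
    rw [hY, hh, nimSum_pairAt_mod hβ hij] at h4
    have hdvd : β 0 ∣ Q := by
      have := place_dvd β hL
      rwa [show place β 1 = β 0 by simp [place]] at this
    -- Adding `3` clears the subtractions in `Q - 1` and `Q - 2`.
    have h5 : (y + z) + (c + d) + 3 ≡ (Q - 1 + (Q - 2)) + 0 + 3 [MOD β 0] :=
      (Nat.ModEq.add (Nat.ModEq.symm h4)
        (Nat.modEq_zero_iff_dvd.2 (Nat.dvd_of_mod_eq_zero h0))).add_right 3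
    rw [show (y + z) + (c + d) + 3 = 4 * Q + 1 by omega,
      show (Q - 1 + (Q - 2)) + 0 + 3 = 2 * Q by omega] at h5
    have h6 : β 0 ∣ 4 * Q + 1 :=
      (Nat.modEq_zero_iff_dvd.1 (h5.trans (Nat.modEq_zero_iff_dvd.2 (hdvd.mul_left 2))))
    have h7 := (Nat.dvd_add_right (hdvd.mul_left 4)).1 h6
    have h8 := hβ 0
    rw [Nat.dvd_one.1 h7] at h8
    omega
  have hch : ∀ x, ∃ x', x' / Q = x / Q ∧ x' ≠ x ∧ x' + d ≠ x + c := by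
    intro x
    have key : ∀ t < Q, (Q * (x / Q) + t) / Q = x / Q := fun t ht => by
      rw [Nat.mul_add_div (by omega), Nat.div_eq_of_lt ht, add_zero]
    -- Only the two values `x` and `x + c - d` are forbidden, and `Q ≥ 3` offers three candidates.
    by_contra! hno
    have e0 := hno _ (key 0 (by omega))
    have e1 := hno _ (key 1 (by omega))
    have e2 := hno _ (key 2 (by omega))
    omega
  obtain ⟨𝒟, h1, h2, h3⟩ := exists_system_disjoint_pairOrbit (L := L) (c := c) (c' := d) hβ hsg
    (by change Q ≤ c; omega) (by change Q ≤ d + 1; omega) hsum hch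
  exact h3 _ ⟨i, j, hij, rfl⟩ (hle 𝒟 h1 h2 hC)

/-- With `Q = 2` the only alternative to `x` is `x + 1` or `x - 1`. From `(5, 2)` to value `0` the
target is `(0, 0)` or `(1, 1)`, so `c - d = 3` and this alternative is never blocked. The digits `2`
and `1` at place `1` do not wrap because `β 1 ≥ 4`. -/
theorem not_hasMinimum_of_four_le (hβ : ∀ L, 2 ≤ β L) (hm : 2 ≤ m) (h0 : β 0 = 2)
    (h1 : 4 ≤ β 1) : ¬ HasMinimumSymmetricSystem (nimSum β m) := by
  rw [hasMinimumSymmetricSystem_iff]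
  rintro ⟨ℳ, hsymm, hsg, hle⟩
  have hplace : place β 1 = 2 := by simp [place, h0]
  obtain ⟨i, j, hij⟩ : ∃ i j : Fin m, i ≠ j :=
    ⟨⟨0, by omega⟩, ⟨1, by omega⟩, by simp [Fin.ext_iff]⟩
  have hlt : 0 < nimSum β m (pairAt i j 5 2) := by
    have := nimSum_pairAt_mod hβ hij 5 2
    rw [h0] at this
    omega
  obtain ⟨C, hC, Y, hYC, hY⟩ := (isSGSystem_iff.1 hsg).2 _ 0 hlt
  obtain ⟨hY2, hC2, hi, hj⟩ := add_eq_pairAt hij hYC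
  generalize Y i = y at *
  generalize Y j = z at *
  generalize C i = c at *
  generalize C j = d at *
  subst hY2 hC2
  have hyz : y / 2 + z / 2 = 0 := by
    have h2 := digit_nimSum_pairAt hβ hij y z 1
    rwa [hY, digit_of_zero, digit_at_one, digit_at_one, h0, ← Nat.add_mod,
      Nat.mod_eq_of_lt (show y / 2 + z / 2 < β 1 by omega), eq_comm] at h2
  have hpar : (y + z) % 2 = 0 := by
    have h2 := nimSum_pairAt_mod hβ hij y z
    rw [hY, h0] at h2
    omega
  obtain ⟨𝒟, h1, h2, h3⟩ := exists_system_disjoint_pairOrbit (L := 1) (c := c) (c' := d) hβ hsg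
    (by omega) (by omega) (by rw [h0]; omega) fun x => by
      rw [hplace]
      rcases Nat.mod_two_eq_zero_or_one x with h | h
      · exact ⟨x + 1, by omega, by omega, by omega⟩
      · exact ⟨x - 1, by omega, by omega, by omega⟩
  exact h3 _ ⟨i, j, hij, rfl⟩ (hle 𝒟 h1 h2 hC)

end Necessity

/-! ### Single-heap moves -/

section SingleHeap

variable {m : ℕ} {β : ℕ → ℕ}

/-- The moves that change one heap only. -/
def singleHeapMoves (m : ℕ) : Set (Fin m → ℕ) :=
  {C | ∃ i, ∃ c, 0 < c ∧ C = Function.update (0 : Fin m → ℕ) i c}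

theorem isSymmetric_singleHeapMoves (m : ℕ) : IsSymmetric (singleHeapMoves m) := by
  rintro _ ⟨i, c, hc, rfl⟩ π
  refine ⟨π.symm i, c, hc, ?_⟩
  funext k
  simp only [Function.update_apply, Equiv.eq_symm_apply, Pi.zero_apply]

theorem add_update_zero (Z : Fin m → ℕ) (i : Fin m) (c : ℕ) :
    Z + Function.update (0 : Fin m → ℕ) i c = Function.update Z i (Z i + c) := by
  funext k
  by_cases h : k = i
  · subst h
    simp
  · simp [h]

theorem nimSum_add_singleHeap_ne (hβ : ∀ L, 2 ≤ β L) {C : Fin m → ℕ}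
    (hC : C ∈ singleHeapMoves m) (Z : Fin m → ℕ) : nimSum β m (Z + C) ≠ nimSum β m Z := by
  obtain ⟨i, c, hc, rfl⟩ := hC
  intro he
  rw [add_update_zero] at he
  have := eq_of_nimSum_update_eq hβ Z i he
  omega

/-- Seen as a position, a single-heap move has only the zero position as an option of value `0`, so
the move itself is forced. -/
theorem singleHeapMoves_subset (hβ : ∀ L, 2 ≤ β L) {𝒟 : Set (Fin m → ℕ)}
    (h𝒟 : IsSGSystem (nimSum β m) 𝒟) : singleHeapMoves m ⊆ 𝒟 := by
  intro X hX
  have hpos : 0 < nimSum β m X := by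
    have := nimSum_add_singleHeap_ne hβ hX 0
    rw [zero_add, nimSum_zero hβ] at this
    omega
  obtain ⟨C, hC, Y, hYC, hY⟩ := (isSGSystem_iff.1 h𝒟).2 X 0 hpos
  obtain ⟨i, c, hc, rfl⟩ := hX
  have hYi : Y = Function.update (0 : Fin m → ℕ) i (Y i) := by
    funext k
    by_cases h : k = i
    · subst h
      simp
    · have hk : Y k + C k = _ := congrFun hYC k
      rw [Function.update_of_ne h] at hk ⊢
      exact (Nat.add_eq_zero_iff.1 hk).1
  have h0 := eq_of_nimSum_update_eq hβ (0 : Fin m → ℕ) i (y := Y i) (by rw [← hYi, hY, nimSum_zero hβ])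
  rw [h0, Pi.zero_apply, Function.update_eq_self_iff.2 (by simp)] at hYi
  rw [hYi, zero_add] at hYC
  exact hYC ▸ hC

theorem exists_singleHeap_move (hβ : ∀ L, 2 ≤ β L) {X : Fin m → ℕ} {h N : ℕ} (i : Fin m)
    (hhigh : h / place β (N + 1) = nimSum β m X / place β (N + 1))
    (hlt : digit β h N < digit β (nimSum β m X) N)
    (hi : digit β (nimSum β m X) N ≤ digit β (X i) N + digit β h N) :
    ∃ C ∈ singleHeapMoves m, ∃ Y, Y + C = X ∧ nimSum β m Y = h := by
  obtain ⟨y, hy, hval⟩ := exists_lt_nimSum_update_eq hβ X i hhigh hlt hi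
  refine ⟨_, ⟨i, X i - y, by omega, rfl⟩, _, ?_, hval⟩
  rw [add_update_zero, Function.update_self, Function.update_idem, Nat.add_sub_cancel' hy.le,
    Function.update_eq_self]

theorem exists_digit_pos (hβ : ∀ L, 2 ≤ β L) {X : Fin m → ℕ} {N : ℕ}
    (h : 0 < digit β (nimSum β m X) N) : ∃ i, 0 < digit β (X i) N := by
  by_contra! hno
  rw [digit_nimSum hβ, Finset.sum_eq_zero fun i _ => Nat.le_zero.1 (hno i), Nat.zero_mod] at h
  exact lt_irrefl _ h

theorem exists_singleHeap_move_of_eq_two (hβ : ∀ L, 2 ≤ β L) {X : Fin m → ℕ} {h N : ℕ}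
    (hN : β N = 2) (hhigh : h / place β (N + 1) = nimSum β m X / place β (N + 1))
    (hlt : digit β h N < digit β (nimSum β m X) N) :
    ∃ C ∈ singleHeapMoves m, ∃ Y, Y + C = X ∧ nimSum β m Y = h := by
  obtain ⟨i, hi⟩ := exists_digit_pos hβ (by omega : 0 < digit β (nimSum β m X) N)
  have := digit_lt hβ (nimSum β m X) N
  exact exists_singleHeap_move hβ i hhigh hlt (by omega)

end SingleHeap

/-! ### Bases with a minimum symmetric system -/

section Sufficiency

variable {m : ℕ} {β : ℕ → ℕ}

/-- Distributes a required decrease of the units digit over the heaps without borrowing. -/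
theorem exists_le_sum_eq (f : Fin m → ℕ) {d : ℕ} (hd : d ≤ ∑ i, f i) :
    ∃ e : Fin m → ℕ, e ≤ f ∧ ∑ i, e i = d := by
  induction d with
  | zero => exact ⟨0, fun i => Nat.zero_le _, by simp⟩
  | succ d ih =>
    obtain ⟨e, he, hsum⟩ := ih (by omega)
    obtain ⟨i, -, hi⟩ := Finset.exists_lt_of_sum_lt (s := Finset.univ) (f := e) (g := f) (by omega)
    refine ⟨Function.update e i (e i + 1), update_le_iff.2 ⟨hi, fun k _ => he k⟩, ?_⟩
    have := sum_update_add (fun n => n) e i (e i + 1)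
    omega

theorem hasMinimum_of_eq_two (hβ : ∀ L, 2 ≤ β L) (h2 : ∀ L, 1 ≤ L → β L = 2) :
    HasMinimumSymmetricSystem (nimSum β m) := by
  have hlegal : ∀ C : Fin m → ℕ, C ≠ 0 → ∑ i, C i < β 0 → (∑ i, C i) % β 0 ≠ 0 := by
    intro C hC hlt h0
    rw [Nat.mod_eq_of_lt hlt] at h0
    exact hC (funext fun i => (Finset.sum_eq_zero_iff.1 h0) i (Finset.mem_univ i))
  refine hasMinimumSymmetricSystem_iff.2
    ⟨singleHeapMoves m ∪ {C | C ≠ 0 ∧ ∑ i, C i < β 0}, ?_, isSGSystem_iff.2 ⟨?_, ?_⟩, ?_⟩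
  · rintro B (hB | ⟨hB, hlt⟩) π
    · exact Or.inl (isSymmetric_singleHeapMoves m B hB π)
    · refine Or.inr ⟨fun h => hB (funext fun i => ?_), by rwa [Equiv.sum_comp π B]⟩
      simpa using congrFun h (π.symm i)
  · rintro C (hC | ⟨hC, hlt⟩)
    · exact nimSum_add_singleHeap_ne hβ hC
    · exact nimSum_add_ne hβ (hlegal C hC hlt)
  · intro X h hh
    obtain ⟨N, hhigh, hlt⟩ := exists_digit_lt hβ hh
    rcases Nat.eq_zero_or_pos N with rfl | hN
    · have hσ := nimSum_mod hβ X
      rw [digit_at_zero, digit_at_zero] at hlt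
      have hb : 0 < β 0 := lt_of_lt_of_le (by norm_num) (hβ 0)
      have hsig := Nat.mod_lt (nimSum β m X) hb
      -- The units digits together are at least the units digit of the Nim sum, so there is enough
      -- to remove.
      have hle : nimSum β m X % β 0 ≤ ∑ i, X i % β 0 := by
        rw [hσ, Finset.sum_nat_mod]
        exact Nat.mod_le _ _
      obtain ⟨e, he, hsum⟩ := exists_le_sum_eq (fun i => X i % β 0)
        (d := nimSum β m X % β 0 - h % β 0) (by omega)
      have heX : e ≤ X := fun i => (he i).trans (Nat.mod_le _ _)
      refine ⟨e, Or.inr ⟨?_, by omega⟩, X - e, tsub_add_cancel_of_le heX, ?_⟩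
      · rintro rfl
        simp at hsum
        omega
      · refine eq_of_digit_eq hβ fun L => ?_
        rcases Nat.eq_zero_or_pos L with rfl | hL
        · rw [digit_at_zero, digit_at_zero, nimSum_mod hβ]
          have h1 : ∑ i, (X - e) i + ∑ i, e i = ∑ i, X i := by
            rw [← Finset.sum_add_distrib]
            exact Finset.sum_congr rfl fun i _ => Nat.sub_add_cancel (heX i)
          have h3 := Nat.mod_add_div (∑ i, X i) (β 0)
          rw [hsum] at h1
          rw [show ∑ i, (X - e) i = h % β 0 + β 0 * ((∑ i, X i) / β 0) by omega,
            Nat.add_mul_mod_self_left, Nat.mod_mod]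
        · rw [digit_eq_of_div_eq hhigh hL, digit_nimSum hβ, digit_nimSum hβ]
          congr 1
          refine Finset.sum_congr rfl fun i _ => digit_eq_of_div_eq (K := 1) ?_ hL
          have h1 := Nat.mod_add_div (X i) (β 0)
          have h3 : e i ≤ X i % β 0 := he i
          have h4 := Nat.mod_lt (X i) hb
          rw [show place β 1 = β 0 by simp [place], Pi.sub_apply,
            show X i - e i = X i % β 0 - e i + β 0 * (X i / β 0) by omega,
            Nat.add_mul_div_left _ _ hb, Nat.div_eq_of_lt (by omega), zero_add]
    · obtain ⟨C, hC, hY⟩ := exists_singleHeap_move_of_eq_two hβ (h2 N hN) hhigh hlt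
      exact ⟨C, Or.inl hC, hY⟩
  · rintro 𝒟 - h𝒟 X (hX | ⟨hX, hlt⟩)
    · exact singleHeapMoves_subset hβ h𝒟 hX
    · have hpos : 0 < nimSum β m X := by
        have := nimSum_add_ne hβ (hlegal X hX hlt) 0
        rw [zero_add, nimSum_zero hβ] at this
        omega
      obtain ⟨C, hC, Y, rfl, hY⟩ := (isSGSystem_iff.1 h𝒟).2 X 0 hpos
      -- A nonzero position of total below `β 0` has nonzero value, so the option of value `0` must
      -- be the origin.
      have hY0 : Y = 0 := by
        by_contra hne
        refine hlegal Y hne (lt_of_le_of_lt ?_ hlt) (by rw [← nimSum_mod hβ, hY, Nat.zero_mod])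
        exact Finset.sum_le_sum fun i _ => Nat.le_add_right _ _
      rwa [hY0, zero_add]

theorem add_pairAt {i j : Fin m} (hij : i ≠ j) (Z : Fin m → ℕ) (a b : ℕ) :
    Z + pairAt i j a b = Function.update (Function.update Z i (Z i + a)) j (Z j + b) := by
  funext k
  by_cases hj : k = j
  · subst hj
    simp [pairAt_right hij]
  · by_cases hi : k = i
    · subst hi
      simp [hj]
    · simp [pairAt, hi, hj]

theorem sum_update_update_add {i j : Fin m} (hij : i ≠ j) (f : ℕ → ℕ) (X : Fin m → ℕ) (y z : ℕ) :
    ∑ k, f (Function.update (Function.update X i y) j z k) + f (X i) + f (X j) =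
      ∑ k, f (X k) + f y + f z := by
  have h1 := sum_update_add f X i y
  have h2 := sum_update_add f (Function.update X i y) j z
  rw [Function.update_of_ne hij.symm] at h2
  omega

theorem place_two_eq_six (h0 : β 0 = 2) (h1 : β 1 = 3)
    :
    place β 2 = 6 := by simp [place, Finset.prod_range_succ, h0, h1]

/-- The total `4` is even, so the units digit gives nothing; instead the digit at place `1`
increases by `2` modulo `3`. -/
theorem nimSum_add_pairAt_two_two_ne (h0 : β 0 = 2) (h1 : β 1 = 3)
    (hβ : ∀ L, 2 ≤ β L) {i j : Fin m} (hij : i ≠ j)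
    (Z : Fin m → ℕ) : nimSum β m (Z + pairAt i j 2 2) ≠ nimSum β m Z := by
  intro he
  have hd := congrArg (fun n => digit β n 1) he
  simp only [digit_nimSum hβ] at hd
  have hs := sum_update_update_add hij (fun n => digit β n 1) Z (Z i + 2) (Z j + 2)
  rw [← add_pairAt hij] at hs
  simp only [digit_at_one, h0, h1] at hd hs
  omega

/-- From `(2, 2)` or `(3, 3)` to a value below `2`, both heaps must fall to at most `1`, leaving
only their parities open. Value `0` from `(2, 2)` allows `(2, 2)` or the inadmissible `(1, 1)`;
value `1` from `(2, 2)` and from `(3, 3)` forces the other two moves up to order. -/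
theorem pairAt_mem_of_isSGSystem (h0 : β 0 = 2) (h1 : β 1 = 3)
    (hβ : ∀ L, 2 ≤ β L) {𝒟 : Set (Fin m → ℕ)}
    (hsymm : IsSymmetric 𝒟) (h𝒟 : IsSGSystem (nimSum β m) 𝒟) {i j : Fin m} (hij : i ≠ j) :
    pairAt i j 2 2 ∈ 𝒟 ∧ pairAt i j 1 2 ∈ 𝒟 ∧ pairAt i j 2 3 ∈ 𝒟 := by
  have hval : ∀ x, x / 2 = 1 → 1 < nimSum β m (pairAt i j x x) := fun x hx => by
    have := digit_nimSum_pairAt hβ hij x x 1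
    simp only [digit_at_one, h0, h1, hx] at this
    omega
  have hswap : ∀ {a b}, pairAt i j b a ∈ 𝒟 → pairAt i j a b ∈ 𝒟 := fun h => by
    rw [pairAt_comm hij] at h
    exact pairAt_mem_of_mem hsymm hij.symm hij h
  have hopt : ∀ x, x / 2 = 1 → ∀ h, h < 2 → ∃ y z c d, pairAt i j c d ∈ 𝒟 ∧ y + c = x ∧
      z + d = x ∧ y ≤ 1 ∧ z ≤ 1 ∧ (y + z) % 2 = h := by
    intro x hx h hh
    obtain ⟨C, hC, Y, hYC, hY⟩ :=
      (isSGSystem_iff.1 h𝒟).2 (pairAt i j x x) h (by have := hval x hx; omega)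
    obtain ⟨hY2, hC2, hi, hj⟩ := add_eq_pairAt hij hYC
    have e0 := nimSum_pairAt_mod hβ hij (Y i) (Y j)
    have e1 := digit_nimSum_pairAt hβ hij (Y i) (Y j) 1
    rw [← hY2, hY] at e0 e1
    simp only [digit_at_one, h0, h1] at e0 e1
    exact ⟨Y i, Y j, C i, C j, hC2 ▸ hC, hi, hj, by omega, by omega, by omega⟩
  refine ⟨?_, ?_, ?_⟩
  · obtain ⟨y, z, c, d, hC, hc, hd, hy, hz, hyz⟩ := hopt 2 (by norm_num) 0 (by norm_num)
    rcases (show (c = 2 ∧ d = 2) ∨ (c = 1 ∧ d = 1) by omega) with ⟨rfl, rfl⟩ | ⟨rfl, rfl⟩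
    · exact hC
    · refine absurd ?_ ((isSGSystem_iff.1 h𝒟).1 _ hC 0)
      rw [zero_add, nimSum_zero hβ]
      refine eq_of_digit_eq hβ fun L => ?_
      rw [digit_nimSum_pairAt hβ hij, digit_of_zero]
      rcases Nat.eq_zero_or_pos L with rfl | hL
      · simp [digit_at_zero, h0]
      · have : digit β 1 L = digit β 0 L :=
          digit_eq_of_div_eq (K := 1) (by simp [place, h0]) hL
        simp [this]
  · obtain ⟨y, z, c, d, hC, hc, hd, hy, hz, hyz⟩ := hopt 2 (by norm_num) 1 (by norm_num)
    rcases (show (c = 1 ∧ d = 2) ∨ (c = 2 ∧ d = 1) by omega) with ⟨rfl, rfl⟩ | ⟨rfl, rfl⟩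
    · exact hC
    · exact hswap hC
  · obtain ⟨y, z, c, d, hC, hc, hd, hy, hz, hyz⟩ := hopt 3 (by norm_num) 1 (by norm_num)
    rcases (show (c = 2 ∧ d = 3) ∨ (c = 3 ∧ d = 2) by omega) with ⟨rfl, rfl⟩ | ⟨rfl, rfl⟩
    · exact hC
    · exact hswap hC

/-- The two-heap moves that lower two digits `1` at the place of weight `2`. -/
theorem exists_two_heap_move (h0 : β 0 = 2) (h1 : β 1 = 3)
    (hβ : ∀ L, 2 ≤ β L) {X : Fin m → ℕ} {h : ℕ} {i j : Fin m}
    (hij : i ≠ j) (hhigh : h / 6 = nimSum β m X / 6) (hσ : nimSum β m X / 2 % 3 = 2)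
    (hh : h / 2 % 3 = 0) (hi : X i / 2 % 3 = 1) (hj : X j / 2 % 3 = 1) :
    ∃ C ∈ pairOrbit m 2 2 ∪ (pairOrbit m 1 2 ∪ pairOrbit m 2 3),
      ∃ Y, Y + C = X ∧ nimSum β m Y = h := by
  have hp := place_two_eq_six h0 h1
  have key : ∀ y z, y / 6 = X i / 6 → z / 6 = X j / 6 → y / 2 % 3 = 0 → z / 2 % 3 = 0 →
      (y + z + nimSum β m X) % 2 = (X i + X j + h) % 2 → y ≤ X i → z ≤ X j →
      ∃ Y, Y + pairAt i j (X i - y) (X j - z) = X ∧ nimSum β m Y = h := by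
    intro y z hy hz hy1 hz1 hpar hyX hzX
    refine ⟨Function.update (Function.update X i y) j z, ?_, ?_⟩
    · rw [add_pairAt hij, Function.update_of_ne hij, Function.update_self, Function.update_self,
        Nat.add_sub_cancel' hyX, Nat.add_sub_cancel' hzX, Function.update_comm hij,
        Function.update_idem]
      simp [Function.update_comm hij]
    · refine eq_of_digit_eq hβ fun L => ?_
      have hs := sum_update_update_add hij (fun n => digit β n L) X y z
      have hX := digit_nimSum hβ X L
      rw [digit_nimSum hβ]
      rcases (show L = 0 ∨ L = 1 ∨ 2 ≤ L by omega) with rfl | rfl | hL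
      · simp only [digit_at_zero, h0] at hs hX ⊢
        omega
      · simp only [digit_at_one, h0, h1] at hs hX ⊢
        omega
      · rw [← hp] at hy hz hhigh
        simp only [digit_eq_of_div_eq hy hL, digit_eq_of_div_eq hz hL] at hs
        rw [digit_eq_of_div_eq hhigh hL, hX]
        congr 1
        omega
  -- Equal parity takes `(2, 2)`. Otherwise one heap must change parity: an even heap loses `1`, and
  -- if both are odd one loses `3`, all without touching the digits from place `2` upward.
  by_cases hpar : h % 2 = nimSum β m X % 2
  · obtain ⟨Y, hY⟩ := key (X i - 2) (X j - 2) (by omega) (by omega) (by omega) (by omega)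
      (by omega) (by omega) (by omega)
    exact ⟨_, Or.inl ⟨i, j, hij, by congr 1 <;> omega⟩, Y, hY⟩
  by_cases hie : X i % 2 = 0
  · obtain ⟨Y, hY⟩ := key (X i - 1) (X j - 2) (by omega) (by omega) (by omega) (by omega)
      (by omega) (by omega) (by omega)
    exact ⟨_, Or.inr (Or.inl ⟨i, j, hij, by congr 1 <;> omega⟩), Y, hY⟩
  by_cases hje : X j % 2 = 0
  · obtain ⟨Y, hY⟩ := key (X i - 2) (X j - 1) (by omega) (by omega) (by omega) (by omega)
      (by omega) (by omega) (by omega)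
    exact ⟨_, Or.inr (Or.inl ⟨j, i, hij.symm, by
      rw [pairAt_comm hij]; congr 1 <;> omega⟩), Y, hY⟩
  · obtain ⟨Y, hY⟩ := key (X i - 2) (X j - 3) (by omega) (by omega) (by omega) (by omega)
      (by omega) (by omega) (by omega)
    exact ⟨_, Or.inr (Or.inr ⟨i, j, hij, by congr 1 <;> omega⟩), Y, hY⟩

theorem hasMinimum_of_two_three (h0 : β 0 = 2) (h1 : β 1 = 3)
    (hβ : ∀ L, 2 ≤ β L) (h2 : ∀ L, 2 ≤ L → β L = 2) :
    HasMinimumSymmetricSystem (nimSum β m) := by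
  have hp := place_two_eq_six h0 h1
  refine hasMinimumSymmetricSystem_iff.2 ⟨singleHeapMoves m ∪
    (pairOrbit m 2 2 ∪ (pairOrbit m 1 2 ∪ pairOrbit m 2 3)), ?_, isSGSystem_iff.2 ⟨?_, ?_⟩, ?_⟩
  · rintro B (hB | hB | hB | hB) π
    · exact Or.inl (isSymmetric_singleHeapMoves m B hB π)
    · exact Or.inr (Or.inl (isSymmetric_pairOrbit m _ _ B hB π))
    · exact Or.inr (Or.inr (Or.inl (isSymmetric_pairOrbit m _ _ B hB π)))
    · exact Or.inr (Or.inr (Or.inr (isSymmetric_pairOrbit m _ _ B hB π)))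
  · rintro C (hC | ⟨i, j, hij, rfl⟩ | ⟨i, j, hij, rfl⟩ | ⟨i, j, hij, rfl⟩)
    · exact nimSum_add_singleHeap_ne hβ hC
    · exact nimSum_add_pairAt_two_two_ne h0 h1 hβ hij
    · exact nimSum_add_ne hβ (by rw [sum_pairAt hij _ _ (fun n => n) rfl, h0]; norm_num)
    · exact nimSum_add_ne hβ (by rw [sum_pairAt hij _ _ (fun n => n) rfl, h0]; norm_num)
  · intro X h hh
    obtain ⟨N, hhigh, hlt⟩ := exists_digit_lt hβ hh
    by_cases hN : N = 1
    · subst hN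
      by_cases hs : ∃ i, digit β (nimSum β m X) 1 ≤ digit β (X i) 1 + digit β h 1
      · obtain ⟨i, hi⟩ := hs
        obtain ⟨C, hC, hY⟩ := exists_singleHeap_move hβ i hhigh hlt hi
        exact ⟨C, Or.inl hC, hY⟩
      -- No single-heap move works only if the digit must go from `2` to `0` while every heap has
      -- digit at most `1`; then at least two heaps have digit `1`.
      · push Not at hs
        obtain ⟨i, hi⟩ := exists_digit_pos hβ (by omega : 0 < digit β (nimSum β m X) 1)
        have hσ := digit_lt hβ (nimSum β m X) 1
        have hsi := hs i
        rw [h1] at hσ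
        have hj : ∃ j, j ≠ i ∧ 0 < digit β (X j) 1 := by
          by_contra! hno
          have := digit_nimSum hβ X 1
          rw [Finset.sum_eq_single i (fun j _ hj => Nat.le_zero.1 (hno j hj)) (by simp), h1] at this
          omega
        obtain ⟨j, hji, hj⟩ := hj
        have hsj := hs j
        rw [hp] at hhigh
        simp only [digit_at_one, h0, h1] at hi hj hsi hsj hσ
        obtain ⟨C, hC, hY⟩ := exists_two_heap_move h0 h1 hβ (X := X) (h := h) hji.symm hhigh
          (by omega) (by omega) (by omega) (by omega)
        exact ⟨C, Or.inr hC, hY⟩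
    · have hN2 : β N = 2 := by
        rcases (show N = 0 ∨ 2 ≤ N by omega) with rfl | h
        · exact h0
        · exact h2 N h
      obtain ⟨C, hC, hY⟩ := exists_singleHeap_move_of_eq_two hβ hN2 hhigh hlt
      exact ⟨C, Or.inl hC, hY⟩
  · rintro 𝒟 hsymm h𝒟 X (hX | ⟨i, j, hij, rfl⟩ | ⟨i, j, hij, rfl⟩ | ⟨i, j, hij, rfl⟩)
    · exact singleHeapMoves_subset hβ h𝒟 hX
    · exact (pairAt_mem_of_isSGSystem h0 h1 hβ hsymm h𝒟 hij).1
    · exact (pairAt_mem_of_isSGSystem h0 h1 hβ hsymm h𝒟 hij).2.1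
    · exact (pairAt_mem_of_isSGSystem h0 h1 hβ hsymm h𝒟 hij).2.2

end Sufficiency

end TakeAway

theorem theorem1p9 (m : ℕ) (hm : 2 ≤ m) (β : ℕ → ℕ) (hβ : ∀ L, 2 ≤ β L) :
    TakeAway.HasMinimumSymmetricSystem (TakeAway.nimSum β m) ↔
      (∀ L, 1 ≤ L → β L = 2) ∨
        (β 0 = 2 ∧ β 1 = 3 ∧ ∀ L, 2 ≤ L → β L = 2) := by
  constructor
  · intro hmin
    have hsmall : ∀ L, 1 ≤ L → 3 ≤ TakeAway.place β L → β L = 2 := fun L hL hQ => by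
      by_contra hne
      have := hβ L
      exact TakeAway.not_hasMinimum_of_three_le_place hβ hm hL (by omega) hQ hmin
    have h2 : ∀ L, 2 ≤ L → β L = 2 := fun L hL => hsmall L (by omega) <| by
      have := (Nat.pow_le_pow_right (by norm_num : 0 < 2) hL).trans
        (TakeAway.two_pow_le_place hβ L)
      omega
    have hcases : ∀ L, 1 ≤ L → L = 1 ∨ 2 ≤ L := fun L hL => by omega
    by_cases h1 : β 1 = 2
    · left
      intro L hL
      rcases hcases L hL with rfl | h
      · exact h1
      · exact h2 L h
    · right
      have h0 : β 0 = 2 := by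
        by_contra hne
        have := hβ 0
        exact h1 (hsmall 1 le_rfl (by simp only [TakeAway.place, Finset.prod_range_one]; omega))
      refine ⟨h0, ?_, h2⟩
      by_contra hne
      have := hβ 1
      exact TakeAway.not_hasMinimum_of_four_le hβ hm h0 (by omega) hmin
  · rintro (h | ⟨h0, h1, h2⟩)
    · exact TakeAway.hasMinimum_of_eq_two hβ h
    · exact TakeAway.hasMinimum_of_two_three h0 h1 hβ h2
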